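/- **Extractable superposition oracle.** Let $\mathcal X$ be a finite linearly ordered set (for example $\{0,1\}^m$ in lexicographic order), $\mathcal Y=\{0,1\}^n$, and $f:\mathcal X\times\mathcal Y\to\mathcal T$ a function. The oracle $\mathsf{eCO}$ holds a database $D=(D_x)_{x\in\mathcal X}$, where each register $D_x$ has the orthonormal basis $\{|y\rangle : y\in\mathcal Y\}\cup\{|\bot\rangle\}$ and initially is in state $|\bot\rangle$. Let $F$ be the unitary that exchanges $|\bot\rangle$ and $|\phi_0\rangle=2^{-n/2}\sum_{y}|y\rangle$ and fixes every vector orthogonal to both. The oracle has two interfaces. * $\mathsf{eCO.RO}$ (quantum access): a query with input register $X$ and output register $Y$ is answered by applying the unitary $O_{XYD}|x\rangle_X=|x\rangle_X\otimes\big(F_{D_x}\,\mathsf{CNOT}^{\otimes n}_{D_x:Y}\,F_{D_x}\big)$, where $\mathsf{CNOT}^{\otimes n}_{D_x:Y}$ maps $|y'\rangle_{D_x}|y\rangle_Y$ to $|y'\rangle_{D_x}|y\oplus y'\rangle_Y$ and fixes $|\bot\rangle_{D_x}|y\rangle_Y$. A parallel query with register pairs $(X_1,Y_1),\dots,(X_w,Y_w)$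 is answered by applying this unitary to the pairs one after the other. * $\mathsf{eCO.E}$ (classical access): a query $t\in\mathcal T$ is answered by the outcome of the projective measurement of $D$ with projectors $\Sigma^{t,x}=\bigotimes_{x'<x}(1-\Pi^{t,x'})_{D_{x'}}\otimes\Pi^{t,x}_{D_x}$ for $x\in\mathcal X$ and $\Sigma^{t,\emptyset}=\bigotimes_{x'\in\mathcal X}(1-\Pi^{t,x'})_{D_{x'}}$, where $\Pi^{t,x}=\sum_{y:\,f(x,y)=t}|y\rangle\langle y|$. **Algorithms.** An algorithm with access to $\mathsf{eCO}$ has finitely many finite-dimensional registers. It makes finitely many steps, each of which is a quantum operation on its own registers (given by finitely many Kraus operators, with a classical outcome), a parallel query to $\mathsf{eCO.RO}$ or a query to $\mathsf{eCO.E}$; its choices may depend on all previous classical outcomes. Its query depth is the largest number of parallel queries to $\mathsf{eCO.RO}$ in a run. **Punctured oracle and FIND.** For $S''\subseteq\mathcal X$, the punctured oracle $\mathsf{eCO}\setminus S''$ differs from $\mathsf{eCO}$ in that each parallel query to $\mathsf{eCO.RO}$ is preceded by the following: with a new flag qubit in state $|0\rangle$, apply $|x_1,\dots,x_w\rangle|b\rangle\mapsto|x_1,\dots,x_w\rangle|b\oplus[x_1\in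 S''\vee\dots\vee x_w\in S'']\rangle$ to the query input registers and the flag, and then measure the flag in the computational basis. FIND is the event that some flag is measured to be $1$. The algorithm does not see the flags. **Input.** Let $\mathsf{GenInp}$ be an algorithm with access to an extractable superposition oracle for $f$. It produces a classical pair $(inp,S'')$ with $S''\subseteq\mathcal X$, so that the set $S''$ is arbitrary: it may be fixed, or have any joint distribution with $inp$. An algorithm $A$ is then run on input $inp$ with access to $\mathsf{eCO}$, which is either the oracle that $\mathsf{GenInp}$ has used (in the state after these uses) or a fresh independent extractable superposition oracle for $f$. **Extractor.** For an integer $d\ge 0$ let $\mathsf{Ext}$ be the algorithm that on input $inp$ picks $i\in\{1,\dots,d\}$ uniformly at random, runs $A^{\mathsf{eCO}}(inp)$ with the unpunctured oracle until just before its $i$-th parallel query to $\mathsf{eCO.RO}$, measures all input registers of this query in the computational basis, and outputs the set $T\subseteq\mathcal X$ of the measurement outcomes ($T=\emptyset$ if $A$ stops before its $i$-th query). **Theorem.** If $A$ has query depth at most $d$ (on every input), then, for either choice of $\mathsf{eCO}$, $$\Pr\big[\mathrm{FIND}: A^{\mathsf{eCO}\setminus S''}(inp)\big]\;\le\;4d\cdot\Pr\big[S''\cap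 T\neq\emptyset : T\leftarrow\mathsf{Ext}(inp)\big],$$ where the probabilities are over the runs of $\mathsf{GenInp}$ and of $A$ resp. $\mathsf{Ext}$. (For $d=0$ the right-hand side is read as $0$.) -/

import Mathlib

namespace ECO

/-- The set `{0,1}^n` of bit strings of length `n`. -/
abbrev Bits (n : ℕ) : Type := Fin n → Bool

/-- Bitwise XOR. -/
def bitXor {n : ℕ} (a b : Bits n) : Bits n := fun i => xor (a i) (b i)

/-- Computational basis of one database register `D_x`: the strings `y`, encoded as `some y`,
and the extra symbol `⊥`, encoded as `none`. -/
abbrev Cell (n : ℕ) : Type := Option (Bits n)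

/-- Computational basis of the database `D = (D_x)_{x ∈ X}`. -/
abbrev DB (X : Type) (n : ℕ) : Type := X → Cell n

/-- Computational basis of the registers of an algorithm: query input registers `X_j` and query
output registers `Y_j` (`j ∈ J`), and a further work register with basis `R`. -/
abbrev Reg (J R X : Type) (n : ℕ) : Type := (J → X) × (J → Bits n) × R

/-- (Unnormalised) joint state vectors of the algorithm's registers and the database. -/
abbrev State (J R X : Type) (n : ℕ) : Type := Reg J R X n × DB X n → ℂ

/-- Squared Euclidean norm of a vector given by its coordinates. -/
noncomputable def normSq {B : Type} [Fintype B] (v : B → ℂ) : ℝ := ∑ b, ‖v b‖ ^ 2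

/-- The vector `|⊥⟩`. -/
def ketBot (n : ℕ) : Cell n → ℂ
  | none => 1
  | some _ => 0

/-- The uniform superposition `|φ₀⟩ = |+⟩^{⊗ n}`. -/
noncomputable def ketUnif (n : ℕ) : Cell n → ℂ
  | none => 0
  | some _ => ((1 / Real.sqrt (2 ^ n) : ℝ) : ℂ)

/-- The unitary `F` that exchanges `|⊥⟩` and `|φ₀⟩` and fixes every vector orthogonal to both:
`F = 1 - |⊥⟩⟨⊥| - |φ₀⟩⟨φ₀| + |⊥⟩⟨φ₀| + |φ₀⟩⟨⊥|` (both vectors have real coordinates). -/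
noncomputable def opF (n : ℕ) : Matrix (Cell n) (Cell n) ℂ :=
  1 - Matrix.vecMulVec (ketBot n) (ketBot n) - Matrix.vecMulVec (ketUnif n) (ketUnif n)
    + Matrix.vecMulVec (ketBot n) (ketUnif n) + Matrix.vecMulVec (ketUnif n) (ketBot n)

/-- `CNOT^{⊗ n}` with a database register as control adds this string to the target register;
the symbol `⊥`, encoded as `1 0^n`, has last `n` bits `0^n`. -/
def cellBits {n : ℕ} : Cell n → Bits n
  | none => fun _ => false
  | some y => y

section Oracle

variable {J R X T : Type} {n : ℕ} [DecidableEq J] [LinearOrder X]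

/-- `F` applied to the database register `D_x`, where `x` is the content of register `X_j`. -/
noncomputable def applyF (j : J) (ψ : State J R X n) : State J R X n :=
  fun z => ∑ c : Cell n,
    opF n (z.2 (z.1.1 j)) c * ψ (z.1, Function.update z.2 (z.1.1 j) c)

/-- `CNOT^{⊗ n}` from `D_x` to `Y_j`, where `x` is the content of register `X_j`: the basis vector
`|x, y, D⟩` is mapped to `|x, y ⊕ D_x, D⟩`. As this map is an involution of the basis, the
amplitude of a basis vector in the image is the amplitude of its own image. -/
def applyCNOT (j : J) (ψ : State J R X n) : State J R X n :=
  fun z => ψ ((z.1.1,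
    Function.update z.1.2.1 j (bitXor (z.1.2.1 j) (cellBits (z.2 (z.1.1 j)))), z.1.2.2), z.2)

/-- The compressed oracle unitary `O_{XYD}` on the register pair `X_j`, `Y_j`. -/
noncomputable def applyO (j : J) (ψ : State J R X n) : State J R X n :=
  applyF j (applyCNOT j (applyF j ψ))

/-- A parallel query with the `k` register pairs `(X_{e 0}, Y_{e 0}), (X_{e 1}, Y_{e 1}), …`: the
unitary `O_{XYD}` is applied to these pairs one after the other. -/
noncomputable def applyRO {k : ℕ} (e : Fin k ↪ J) (ψ : State J R X n) : State J R X n :=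
  (List.finRange k).foldl (fun φ i => applyO (e i) φ) ψ

/-- `D_x` contains a string `y` with `f x y = t`. -/
def cellHit (f : X → Bits n → T) (t : T) (D : DB X n) (x : X) : Prop :=
  ∃ y, D x = some y ∧ f x y = t

/-- The projector `Σ^{t,x}` (`some x`: `D_x` is the first register that contains some `y` with
`f x y = t`) or `Σ^{t,∅}` (`none`: no register contains such a `y`). -/
def selects (f : X → Bits n → T) (t : T) (D : DB X n) : Option X → Prop
  | some x => cellHit f t D x ∧ ∀ x' < x, ¬ cellHit f t D x'
  | none => ∀ x', ¬ cellHit f t D x'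

open Classical in
/-- A query with the classical value `t` to the extraction interface, answered by `o`: the
projector of the measurement outcome `o` is applied to the database. -/
noncomputable def applyE (f : X → Bits n → T) (t : T) (o : Option X) (ψ : State J R X n) :
    State J R X n :=
  fun z => if selects f t z.2 o then ψ z else 0

/-- The unitary of the semi-classical oracle for `S` on the query input registers
`X_{e 0}, X_{e 1}, …` and a flag qubit:
`|x_1, …, x_k⟩|b⟩ ↦ |x_1, …, x_k⟩|b ⊕ [x_1 ∈ S ∨ … ∨ x_k ∈ S]⟩`. -/
def applyFlag (S : Finset X) {k : ℕ} (e : Fin k ↪ J)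
    (Ψ : (Reg J R X n × DB X n) × Bool → ℂ) : (Reg J R X n × DB X n) × Bool → ℂ :=
  fun z => Ψ (z.1, xor z.2 (decide (∃ i, z.1.1.1 (e i) ∈ S)))

/-- The semi-classical oracle for `S`: a fresh flag qubit `|0⟩` is adjoined, `applyFlag` is
applied, and the flag is measured with outcome `b`. The result is the (unnormalised)
post-measurement state of the other registers. -/
def semiClassical (S : Finset X) {k : ℕ} (e : Fin k ↪ J) (b : Bool) (ψ : State J R X n) :
    State J R X n :=
  fun z => applyFlag S e (fun w => if w.2 = false then ψ w.1 else 0) (z, b)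

end Oracle

/-- A matrix on the algorithm's registers, applied to the joint state. -/
noncomputable def applyLocal {J R X : Type} {n : ℕ} [Fintype J] [DecidableEq J] [Fintype R]
    [Fintype X] (K : Matrix (Reg J R X n) (Reg J R X n) ℂ) (ψ : State J R X n) :
    State J R X n :=
  fun z => ∑ r, K z.1 r * ψ (r, z.2)

/-- Quantum algorithms with access to the two interfaces of an extractable superposition oracle,
with classical output in `α`. The control flow may depend on all classical outcomes so far.
* `ret a`: stop with output `a`.
* `step K _ next`: perform the quantum operation on the own registers with Kraus operators
  `K i` (for example a unitary, a measurement, a preparation, or a coin flip) and go on with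
  `next i` if the outcome is `i`.
* `queryRO e next`: send the register pairs `(X_{e 0}, Y_{e 0}), …, (X_{e (k-1)}, Y_{e (k-1)})` as
  one parallel query to the random oracle interface.
* `queryE t next`: send the classical value `t` to the extraction interface and go on with
  `next o` if the answer is `o` (where `none` stands for `∅`). -/
inductive OracleAlg (J R X : Type) (n : ℕ) (T α : Type) [Fintype J] [DecidableEq J] [Fintype R]
    [DecidableEq R] [Fintype X] [LinearOrder X] : Type 1
  | ret (a : α) : OracleAlg J R X n T α
  | step {ι : Type} [Fintype ι] (K : ι → Matrix (Reg J R X n) (Reg J R X n) ℂ)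
      (hK : ∑ i, (K i).conjTranspose * K i = 1) (next : ι → OracleAlg J R X n T α) :
      OracleAlg J R X n T α
  | queryRO {k : ℕ} (e : Fin k ↪ J) (next : OracleAlg J R X n T α) : OracleAlg J R X n T α
  | queryE (t : T) (next : Option X → OracleAlg J R X n T α) : OracleAlg J R X n T α

section Algorithms

variable {J R X T α : Type} {n : ℕ} [Fintype J] [DecidableEq J] [Fintype R]
    [DecidableEq R] [Fintype X] [LinearOrder X]

namespace OracleAlg

/-- The query depth with respect to the random oracle interface: the largest number of (parallel)
queries to that interface in a run. -/
def queryDepth : OracleAlg J R X n T α → ℕ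
  | ret _ => 0
  | step _ _ next => Finset.univ.sup fun i => (next i).queryDepth
  | queryRO _ next => next.queryDepth + 1
  | queryE _ next => Finset.univ.sup fun o => (next o).queryDepth

/-- The run with the (unpunctured) oracle on a joint state: the family of all branches, each with
its classical output and its unnormalised final state. The probability of a branch is the squared
norm of that state. -/
noncomputable def run (f : X → Bits n → T) :
    OracleAlg J R X n T α → State J R X n → Multiset (α × State J R X n)
  | ret a, ψ => {(a, ψ)}
  | step K _ next, ψ => Finset.univ.val.bind fun i => (next i).run f (applyLocal (K i) ψ)
  | queryRO e next, ψ => next.run f (applyRO e ψ)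
  | queryE t next, ψ => Finset.univ.val.bind fun o => (next o).run f (applyE f t o ψ)

/-- The run with the oracle punctured on `S`: every random oracle query is preceded by the
semi-classical oracle for `S`. A branch also records the list of the measured flags, which the
algorithm does not see. -/
noncomputable def runPunctured (f : X → Bits n → T) (S : Finset X) :
    OracleAlg J R X n T α → State J R X n → Multiset ((α × List Bool) × State J R X n)
  | ret a, ψ => {((a, []), ψ)}
  | step K _ next, ψ =>
      Finset.univ.val.bind fun i => (next i).runPunctured f S (applyLocal (K i) ψ)
  | queryRO e next, ψ =>
      Finset.univ.val.bind fun b : Bool =>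
        (next.runPunctured f S (applyRO e (semiClassical S e b ψ))).map
          fun p => ((p.1.1, b :: p.1.2), p.2)
  | queryE t next, ψ =>
      Finset.univ.val.bind fun o => (next o).runPunctured f S (applyE f t o ψ)

/-- Kraus operators of the measurement of the query input registers `X_{e 0}, X_{e 1}, …` in the
computational basis: the projectors on the outcomes `x`. -/
def measureInputs {k : ℕ} (e : Fin k ↪ J) (x : Fin k → X) :
    Matrix (Reg J R X n) (Reg J R X n) ℂ :=
  Matrix.diagonal fun r => if (fun i => r.1 (e i)) = x then 1 else 0

theorem measureInputs_complete {k : ℕ} (e : Fin k ↪ J) :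
    ∑ x : Fin k → X, (measureInputs (R := R) (n := n) e x).conjTranspose * measureInputs e x
      = 1 := by
  have h : ∀ x : Fin k → X, (measureInputs (R := R) (n := n) e x).conjTranspose *
      measureInputs e x = measureInputs e x := by
    intro x
    simp only [measureInputs, Matrix.diagonal_conjTranspose, Matrix.diagonal_mul_diagonal]
    congr 1
    funext r
    by_cases hr : (fun i => r.1 (e i)) = x <;> simp [hr]
  simp only [h]
  ext r s
  rw [Matrix.sum_apply]
  by_cases hrs : r = s
  · subst hrs
    simp [measureInputs]
  · simp [measureInputs, Matrix.diagonal_apply_ne _ hrs, Matrix.one_apply_ne hrs]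

/-- The algorithm that runs `A` until just before its query number `i + 1` to the random oracle
interface, then measures all input registers of that query in the computational basis and outputs
the set of measurement outcomes. If `A` stops before that query, the output is empty. -/
def extractor : OracleAlg J R X n T α → ℕ → OracleAlg J R X n T (Finset X)
  | ret _, _ => ret ∅
  | step K hK next, i => step K hK fun a => (next a).extractor i
  | queryRO e _, 0 =>
      step (measureInputs e) (measureInputs_complete e) fun x => ret (Finset.univ.image x)
  | queryRO e next, i + 1 => queryRO e (next.extractor i)
  | queryE t next, i => queryE t fun o => (next o).extractor i

end OracleAlg

/-- The joint state in which the algorithm's registers are in state `φ` and the database is in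
state `δ`. -/
def tensor (φ : Reg J R X n → ℂ) (δ : DB X n → ℂ) : State J R X n :=
  fun z => φ z.1 * δ z.2

/-- The initial state `|⊥⟩^{⊗ X}` of the database. -/
def initDB (X : Type) (n : ℕ) [Fintype X] : DB X n → ℂ :=
  fun D => if D = fun _ => none then 1 else 0

end Algorithms

/-- An oracle algorithm with the initial (pure) state of its own registers. -/
structure QAlg (J R X : Type) (n : ℕ) (T α : Type) [Fintype J] [DecidableEq J] [Fintype R]
    [DecidableEq R] [Fintype X] [LinearOrder X] where
  init : Reg J R X n → ℂ
  init_unit : normSq init = 1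
  prog : OracleAlg J R X n T α

/-- Which oracle the algorithm gets after its input was generated: the very oracle that the input
generation has used, or a fresh, independent one. -/
inductive OracleLink
  | same
  | fresh

section Experiments

variable {J R J₀ R₀ X T Inp β : Type} {n : ℕ} [Fintype J] [DecidableEq J] [Fintype R]
    [DecidableEq R] [Fintype J₀] [DecidableEq J₀] [Fintype R₀] [DecidableEq R₀]
    [Fintype X] [LinearOrder X]

/-- The situation after the input generation: all branches, each with the generated pair of an
input and a set and with the (unnormalised) database state of the oracle that is handed to the
algorithm. The input generator's own registers are discarded (traced out, by a measurement of them
in the computational basis with an outcome that nobody uses); for a fresh oracle, so is the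
database that the generator has used. -/
noncomputable def inputPhase (f : X → Bits n → T) (c : OracleLink)
    (G : QAlg J₀ R₀ X n T (Inp × Finset X)) :
    Multiset ((Inp × Finset X) × (DB X n → ℂ)) :=
  (G.prog.run f (tensor G.init (initDB X n))).bind fun p =>
    match c with
    | .same => Finset.univ.val.map fun g : Reg J₀ R₀ X n => (p.1, fun D => p.2 (g, D))
    | .fresh => Finset.univ.val.map fun g : Reg J₀ R₀ X n × DB X n =>
        (p.1, fun D => p.2 g * initDB X n D)

/-- The probability of FIND, the event that some flag is measured to be `1`, in the run of `A` on
the generated input with the oracle punctured on the generated set. -/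
noncomputable def prFind (f : X → Bits n → T) (c : OracleLink)
    (G : QAlg J₀ R₀ X n T (Inp × Finset X)) (A : Inp → QAlg J R X n T β) : ℝ :=
  ((inputPhase f c G).map fun p =>
    (((A p.1.1).prog.runPunctured f p.1.2 (tensor (A p.1.1).init p.2)).map fun q =>
      if true ∈ q.1.2 then normSq q.2 else 0).sum).sum

/-- The probability that the output of the extractor meets the generated set, where the extractor
measures the query number `i + 1` of the unpunctured run of `A` for a uniformly random
`i ∈ {0, …, d - 1}`. -/
noncomputable def prExtract (f : X → Bits n → T) (c : OracleLink) (d : ℕ)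
    (G : QAlg J₀ R₀ X n T (Inp × Finset X)) (A : Inp → QAlg J R X n T β) : ℝ :=
  (1 / d : ℝ) * ∑ i ∈ Finset.range d,
    ((inputPhase f c G).map fun p =>
      ((((A p.1.1).prog.extractor i).run f (tensor (A p.1.1).init p.2)).map fun q =>
        if (p.1.2 ∩ q.1).Nonempty then normSq q.2 else 0).sum).sum

end Experiments

end ECO

namespace ECO

/-! ### Norms -/

/-! This is semi-classical one-way to hiding, proved by comparing two runs on the same classical
outcomes: the punctured run from a state `ψ` and the unpunctured run, which the extractor follows,
from a state `ψ'`. `findWeight_le` shows that FIND has weight at most `2‖ψ' - ψ‖²` plus four times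
the sum over `i` of the extractor's success weights. For `ψ' = ψ` the distance term vanishes, and
averaging over `i` turns the sum into `d` times the extraction probability.

The induction is on the program. Kraus operations and extraction queries conserve the squared
distance and split both weights over the outcomes. At a random oracle query, let `P₁` be the
projector on inputs meeting `S`, `P₀ = 1 - P₁` and `δ = ψ' - ψ`. FIND occurs at once with weight
`‖P₁ψ‖² ≤ 2‖P₁ψ'‖² + 2‖P₁δ‖²`; otherwise the new squared distance is `‖ψ' - P₀ψ‖² = ‖P₀δ‖² +
‖P₁ψ'‖²`. In total the query costs `4‖P₁ψ'‖²`, four times the weight with which measuring this query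
hits `S`, and `2‖P₁δ‖² + 2‖P₀δ‖² = 2‖δ‖²` is what was available.

Of the oracle only this enters: `eCO.RO` is linear and preserves norms, and `eCO.E` is a projective
measurement. So any database state, normalised or not, is allowed. -/

theorem normSq_nonneg {B : Type} [Fintype B] (v : B → ℂ) : 0 ≤ normSq v :=
  Finset.sum_nonneg fun _ _ => sq_nonneg _

theorem normSq_zero {B : Type} [Fintype B] : normSq (0 : B → ℂ) = 0 := by
  simp [normSq]

theorem normSq_eq_dotProduct {B : Type} [Fintype B] (v : B → ℂ) :
    (normSq v : ℂ) = dotProduct (star v) v := by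
  simp [normSq, dotProduct, Complex.conj_mul']

/-- The only lossy estimate made at a query: the cross term is bounded by `2ab ≤ a² + b²`. -/
theorem normSq_sub_le {B : Type} [Fintype B] (v w : B → ℂ) :
    normSq (v - w) ≤ 2 * normSq v + 2 * normSq w := by
  simp only [normSq, Finset.mul_sum, ← Finset.sum_add_distrib]
  refine Finset.sum_le_sum fun b _ => ?_
  have h := norm_sub_le (v b) (w b)
  have h0 := norm_nonneg (v b - w b)
  rw [Pi.sub_apply]
  nlinarith [sq_nonneg (‖v b‖ - ‖w b‖)]

/-- A complete family of Kraus operators preserves the total squared norm. -/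
theorem sum_normSq_mulVec {B ι : Type} [Fintype B] [DecidableEq B] [Fintype ι]
    (K : ι → Matrix B B ℂ) (hK : ∑ i, (K i).conjTranspose * K i = 1) (v : B → ℂ) :
    ∑ i, normSq ((K i).mulVec v) = normSq v := by
  have h : ∀ i, (normSq ((K i).mulVec v) : ℂ)
      = dotProduct (star v) (((K i).conjTranspose * K i).mulVec v) := by
    intro i
    rw [normSq_eq_dotProduct, Matrix.star_mulVec, ← Matrix.dotProduct_mulVec,
      Matrix.mulVec_mulVec]
  have h2 : ((∑ i, normSq ((K i).mulVec v) : ℝ) : ℂ) = (normSq v : ℂ) := by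
    push_cast
    rw [Finset.sum_congr rfl fun i _ => h i, ← dotProduct_sum, ← Matrix.sum_mulVec, hK,
      Matrix.one_mulVec, normSq_eq_dotProduct]
  exact_mod_cast h2

theorem normSq_prod_left {B C : Type} [Fintype B] [Fintype C] (v : B × C → ℂ) :
    normSq v = ∑ c, normSq fun b => v (b, c) := by
  simp only [normSq, Fintype.sum_prod_type_right]

theorem normSq_prod_right {B C : Type} [Fintype B] [Fintype C] (v : B × C → ℂ) :
    normSq v = ∑ b, normSq fun c => v (b, c) := by
  simp only [normSq, Fintype.sum_prod_type]

theorem normSq_comp_equiv {B C : Type} [Fintype B] [Fintype C] (e : B ≃ C) (v : C → ℂ) :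
    normSq (fun b => v (e b)) = normSq v :=
  Equiv.sum_comp e fun c => ‖v c‖ ^ 2

/-! ### The operator `F` -/

/-- Exchanging two orthonormal vectors is the reflection along their difference. That difference has
squared length 2, so no normalising factor appears. -/
theorem opF_eq (n : ℕ) :
    opF n = 1 - Matrix.vecMulVec (ketBot n - ketUnif n) (ketBot n - ketUnif n) := by
  ext a b
  simp only [opF, Matrix.sub_apply, Matrix.add_apply, Matrix.vecMulVec_apply, Pi.sub_apply]
  ring

theorem ket_dotProduct (n : ℕ) :
    dotProduct (ketBot n - ketUnif n) (ketBot n - ketUnif n) = 2 := by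
  have h : ((Real.sqrt (2 ^ n) : ℝ) : ℂ) ^ 2 = 2 ^ n := by
    rw [← Complex.ofReal_pow, Real.sq_sqrt (by positivity)]
    push_cast
    rfl
  simp only [dotProduct, Fintype.sum_option, Pi.sub_apply, ketBot, ketUnif, sub_zero, zero_sub,
    neg_mul_neg, Finset.sum_const, Finset.card_univ, Fintype.card_fun, Fintype.card_bool,
    Fintype.card_fin, nsmul_eq_mul]
  push_cast
  rw [← pow_two ((1 : ℂ) / _), div_pow, h]
  field_simp
  norm_num

theorem opF_isHermitian (n : ℕ) : (opF n).conjTranspose = opF n := by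
  have h : ∀ c, star ((ketBot n - ketUnif n) c) = (ketBot n - ketUnif n) c := by
    rintro (_ | y) <;> simp [ketBot, ketUnif]
  rw [opF_eq]
  ext a b
  simp only [Matrix.conjTranspose_apply, Matrix.sub_apply, Matrix.vecMulVec_apply, star_sub,
    star_mul, h, Matrix.one_apply, apply_ite star, star_one, star_zero, eq_comm (a := b)]

theorem opF_mul_self (n : ℕ) : opF n * opF n = 1 := by
  rw [opF_eq, mul_sub, sub_mul, sub_mul, Matrix.vecMulVec_mul_vecMulVec, ket_dotProduct]
  ext a b
  simp [Matrix.vecMulVec_apply]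
  ring

theorem normSq_opF_mulVec (n : ℕ) (v : Cell n → ℂ) : normSq ((opF n).mulVec v) = normSq v := by
  have h := sum_normSq_mulVec (fun _ : Unit => opF n)
    (by simp [opF_isHermitian, opF_mul_self]) v
  simpa using h

/-- A matrix acting isometrically on one coordinate acts isometrically on all functions. -/
theorem normSq_update {X C : Type} [Fintype X] [DecidableEq X] [Fintype C] (U : Matrix C C ℂ)
    (hU : ∀ v, normSq (U.mulVec v) = normSq v) (x : X) (w : (X → C) → ℂ) :
    normSq (fun D => ∑ c, U (D x) c * w (Function.update D x c)) = normSq w := by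
  -- Split off coordinate `x`: for each fixed content of the other coordinates, the map is `U` on a
  -- single vector.
  have h : ∀ v : (X → C) → ℂ, normSq v =
      ∑ D', normSq fun a => v ((Equiv.funSplitAt x C).symm (a, D')) := fun v => by
    rw [← normSq_comp_equiv (Equiv.funSplitAt x C).symm v, normSq_prod_left]
  rw [h, h w]
  refine Finset.sum_congr rfl fun D' _ => ?_
  refine Eq.trans ?_ (hU _)
  congr 1
  funext a
  simp only [Matrix.mulVec, dotProduct]
  refine Finset.sum_congr rfl fun c _ => ?_
  congr 2
  · simp [Equiv.funSplitAt, Equiv.piSplitAt]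
  · funext x'
    by_cases h : x' = x
    · subst h
      simp [Equiv.funSplitAt, Equiv.piSplitAt]
    · simp [Equiv.funSplitAt, Equiv.piSplitAt, h]

/-! ### Linearity: the difference of two runs evolves under the same maps -/

section Linearity

variable {J R X T : Type} {n : ℕ}

theorem applyLocal_sub [Fintype J] [DecidableEq J] [Fintype R] [Fintype X]
    (K : Matrix (Reg J R X n) (Reg J R X n) ℂ) (ψ φ : State J R X n) :
    applyLocal K (ψ - φ) = applyLocal K ψ - applyLocal K φ := by
  funext z
  simp only [applyLocal, Pi.sub_apply, mul_sub, Finset.sum_sub_distrib]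

variable [LinearOrder X]

theorem applyF_sub (j : J) (ψ φ : State J R X n) :
    applyF j (ψ - φ) = applyF j ψ - applyF j φ := by
  funext z
  simp only [applyF, Pi.sub_apply, mul_sub, Finset.sum_sub_distrib]

theorem applyE_sub (f : X → Bits n → T) (t : T) (o : Option X) (ψ φ : State J R X n) :
    applyE f t o (ψ - φ) = applyE f t o ψ - applyE f t o φ := by
  funext z
  by_cases h : selects f t z.2 o <;> simp [applyE, h]

/-- Adjoining a fresh flag, computing into it and measuring it amounts to a diagonal projector. -/
theorem semiClassical_apply (S : Finset X) {k : ℕ} (e : Fin k ↪ J) (b : Bool)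
    (ψ : State J R X n) (z : Reg J R X n × DB X n) :
    semiClassical S e b ψ z = if decide (∃ i, z.1.1 (e i) ∈ S) = b then ψ z else 0 := by
  cases b <;> by_cases h : ∃ i, z.1.1 (e i) ∈ S <;> simp [semiClassical, applyFlag, h]

theorem semiClassical_sub (S : Finset X) {k : ℕ} (e : Fin k ↪ J) (b : Bool)
    (ψ φ : State J R X n) :
    semiClassical S e b (ψ - φ) = semiClassical S e b ψ - semiClassical S e b φ := by
  funext z
  simp only [semiClassical_apply, Pi.sub_apply]
  split_ifs <;> simp

variable [DecidableEq J]

theorem applyO_sub (j : J) (ψ φ : State J R X n) :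
    applyO j (ψ - φ) = applyO j ψ - applyO j φ := by
  have h : ∀ ψ φ : State J R X n, applyCNOT j (ψ - φ) = applyCNOT j ψ - applyCNOT j φ :=
    fun _ _ => rfl
  simp only [applyO, applyF_sub, h]

theorem applyRO_sub {k : ℕ} (e : Fin k ↪ J) (ψ φ : State J R X n) :
    applyRO e (ψ - φ) = applyRO e ψ - applyRO e φ := by
  unfold applyRO
  induction List.finRange k generalizing ψ φ with
  | nil => rfl
  | cons i l ih => simp only [List.foldl_cons, applyO_sub, ih]

end Linearity

/-! ### Norm conservation for the oracle interfaces and measurements -/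

section Operators

variable {J R X T : Type} {n : ℕ} [Fintype J] [DecidableEq J] [Fintype R]
    [Fintype X] [LinearOrder X]

theorem normSq_applyF (j : J) (ψ : State J R X n) : normSq (applyF j ψ) = normSq ψ := by
  rw [normSq_prod_right, normSq_prod_right ψ]
  exact Finset.sum_congr rfl fun r _ =>
    normSq_update (opF n) (normSq_opF_mulVec n) (r.1 j) fun D => ψ (r, D)

theorem bitXor_bitXor {n : ℕ} (a b : Bits n) : bitXor (bitXor a b) b = a := by
  funext i
  simp [bitXor]

theorem normSq_applyCNOT (j : J) (ψ : State J R X n) : normSq (applyCNOT j ψ) = normSq ψ := by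
  -- The basis permutation behind the operator; it is an involution because the control `D_x` and
  -- the address `x` are left unchanged.
  let g : Reg J R X n × DB X n → Reg J R X n × DB X n := fun z => ((z.1.1,
    Function.update z.1.2.1 j (bitXor (z.1.2.1 j) (cellBits (z.2 (z.1.1 j)))), z.1.2.2), z.2)
  have hg : Function.Involutive g := by
    rintro ⟨⟨x, y, r⟩, D⟩
    simp [g, bitXor_bitXor]
  exact normSq_comp_equiv hg.toPerm ψ

theorem normSq_applyRO {k : ℕ} (e : Fin k ↪ J) (ψ : State J R X n) :
    normSq (applyRO e ψ) = normSq ψ := by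
  unfold applyRO
  induction List.finRange k generalizing ψ with
  | nil => rfl
  | cons i l ih => rw [List.foldl_cons, ih, applyO, normSq_applyF, normSq_applyCNOT,
      normSq_applyF]

/-- The answer is the least register that is hit, or `none`. Hence the projectors for the different
answers partition the basis of the database. -/
theorem existsUnique_selects (f : X → Bits n → T) (t : T) (D : DB X n) :
    ∃! o, selects f t D o := by
  classical
  by_cases h : ∃ x, cellHit f t D x
  · obtain ⟨x, hx, hmin⟩ := (Set.toFinite {x | cellHit f t D x}).exists_minimal h
    have hlt : ∀ x' < x, ¬ cellHit f t D x' := fun x' hx' hc =>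
      absurd (hmin hc hx'.le) (not_le.mpr hx')
    refine ⟨some x, ⟨hx, hlt⟩, ?_⟩
    rintro (_ | x') ho
    · exact absurd hx (ho x)
    · rcases lt_trichotomy x' x with h1 | h1 | h1
      · exact absurd ho.1 (hlt x' h1)
      · rw [h1]
      · exact absurd hx (ho.2 x h1)
  · push Not at h
    refine ⟨none, h, ?_⟩
    rintro (_ | x') ho
    · rfl
    · exact absurd ho.1 (h x')

theorem sum_normSq_applyE (f : X → Bits n → T) (t : T) (ψ : State J R X n) :
    ∑ o, normSq (applyE f t o ψ) = normSq ψ := by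
  classical
  simp only [normSq]
  rw [Finset.sum_comm]
  refine Finset.sum_congr rfl fun z _ => ?_
  obtain ⟨o, ho, huniq⟩ := existsUnique_selects f t z.2
  rw [Finset.sum_eq_single o]
  · simp [applyE, ho]
  · intro o' _ hne
    have : ¬ selects f t z.2 o' := fun h => hne (huniq o' h)
    simp [applyE, this]
  · simp

theorem sum_normSq_semiClassical (S : Finset X) {k : ℕ} (e : Fin k ↪ J) (ψ : State J R X n) :
    normSq (semiClassical S e true ψ) + normSq (semiClassical S e false ψ) = normSq ψ := by
  simp only [normSq, semiClassical_apply, ← Finset.sum_add_distrib]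
  refine Finset.sum_congr rfl fun z _ => ?_
  by_cases h : ∃ i, z.1.1 (e i) ∈ S <;> simp [h]

/-- Replacing `ψ` by its part that does not query `S` changes the distance to `ψ'` only by the
part of `ψ'` that queries `S`. -/
theorem normSq_sub_semiClassical (S : Finset X) {k : ℕ} (e : Fin k ↪ J)
    (ψ ψ' : State J R X n) :
    normSq (ψ' - semiClassical S e false ψ) =
      normSq (semiClassical S e false (ψ' - ψ)) + normSq (semiClassical S e true ψ') := by
  simp only [normSq, semiClassical_apply, ← Finset.sum_add_distrib, Pi.sub_apply]
  refine Finset.sum_congr rfl fun z _ => ?_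
  by_cases h : ∃ i, z.1.1 (e i) ∈ S <;> simp [h]

variable [DecidableEq R]

theorem sum_normSq_applyLocal {ι : Type} [Fintype ι]
    (K : ι → Matrix (Reg J R X n) (Reg J R X n) ℂ)
    (hK : ∑ i, (K i).conjTranspose * K i = 1) (ψ : State J R X n) :
    ∑ i, normSq (applyLocal (K i) ψ) = normSq ψ := by
  rw [normSq_prod_left ψ, Finset.sum_congr rfl fun i _ => normSq_prod_left (applyLocal (K i) ψ),
    Finset.sum_comm]
  exact Finset.sum_congr rfl fun D _ => sum_normSq_mulVec K hK fun r => ψ (r, D)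

/-- Links extraction to FIND: the input tuples that meet `S` are exactly those that set the flag, so
measuring all inputs merely refines the flag measurement. -/
theorem sum_normSq_measureInputs (S : Finset X) {k : ℕ} (e : Fin k ↪ J) (ψ : State J R X n) :
    (∑ x : Fin k → X, if (S ∩ Finset.univ.image x).Nonempty then
      normSq (applyLocal (OracleAlg.measureInputs e x) ψ) else 0) =
      normSq (semiClassical S e true ψ) := by
  have hm : ∀ (x : Fin k → X) (z : Reg J R X n × DB X n),
      applyLocal (OracleAlg.measureInputs e x) ψ z
        = if x = (fun i => z.1.1 (e i)) then ψ z else 0 := by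
    intro x z
    simp [applyLocal, OracleAlg.measureInputs, Matrix.diagonal_apply, eq_comm (a := x)]
  have hS : ∀ x : Fin k → X, (S ∩ Finset.univ.image x).Nonempty ↔ ∃ i, x i ∈ S := by
    intro x
    constructor
    · rintro ⟨a, ha⟩
      obtain ⟨h1, h2⟩ := Finset.mem_inter.mp ha
      obtain ⟨i, -, rfl⟩ := Finset.mem_image.mp h2
      exact ⟨i, h1⟩
    · rintro ⟨i, hi⟩
      exact ⟨x i, Finset.mem_inter.mpr ⟨hi, Finset.mem_image_of_mem _ (Finset.mem_univ i)⟩⟩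
  have hsum : ∀ x : Fin k → X, (if (S ∩ Finset.univ.image x).Nonempty then
      normSq (applyLocal (OracleAlg.measureInputs e x) ψ) else 0) =
      ∑ z, if x = (fun i => z.1.1 (e i)) then (if ∃ i, x i ∈ S then ‖ψ z‖ ^ 2 else 0) else 0 := by
    intro x
    by_cases h : ∃ i, x i ∈ S
    · rw [if_pos ((hS x).mpr h)]
      refine Finset.sum_congr rfl fun z _ => ?_
      rw [hm, if_pos h]
      split_ifs <;> simp
    · rw [if_neg (fun h' => h ((hS x).mp h'))]
      simp [h]
  rw [Finset.sum_congr rfl fun x _ => hsum x, Finset.sum_comm]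
  refine Finset.sum_congr rfl fun z _ => ?_
  rw [Finset.sum_ite_eq' Finset.univ, semiClassical_apply]
  by_cases h : ∃ i, z.1.1 (e i) ∈ S <;> simp [h]

end Operators

/-! ### Branching runs -/

theorem sum_map_bind_univ {ι B : Type} [Fintype ι] (m : ι → Multiset B) (g : B → ℝ) :
    ((Finset.univ.val.bind m).map g).sum = ∑ i, ((m i).map g).sum := by
  rw [Multiset.map_bind, Multiset.sum_bind]
  rfl

section Runs

variable {J R X T α : Type} {n : ℕ} [Fintype J] [DecidableEq J] [Fintype R]
    [DecidableEq R] [Fintype X] [LinearOrder X]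

namespace OracleAlg

/-- The weight of the branches of a punctured run in which some flag is measured to be `1`. -/
noncomputable def findWeight (f : X → Bits n → T) (S : Finset X) (P : OracleAlg J R X n T α)
    (ψ : State J R X n) : ℝ :=
  ((P.runPunctured f S ψ).map fun q => if true ∈ q.1.2 then normSq q.2 else 0).sum

/-- The weight of the branches of a run whose output meets `S`. -/
noncomputable def hitWeight (f : X → Bits n → T) (S : Finset X)
    (P : OracleAlg J R X n T (Finset X)) (ψ : State J R X n) : ℝ :=
  ((P.run f ψ).map fun q => if (S ∩ q.1).Nonempty then normSq q.2 else 0).sum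

theorem hitWeight_nonneg (f : X → Bits n → T) (S : Finset X)
    (P : OracleAlg J R X n T (Finset X)) (ψ : State J R X n) : 0 ≤ P.hitWeight f S ψ := by
  refine Multiset.sum_nonneg fun a ha => ?_
  obtain ⟨q, -, rfl⟩ := Multiset.mem_map.mp ha
  split_ifs
  exacts [normSq_nonneg _, le_rfl]

/-- Needed once a flag has been 1: every continuation then counts for FIND, so their total weight is
the norm at that moment. -/
theorem sum_normSq_runPunctured (f : X → Bits n → T) (S : Finset X)
    (P : OracleAlg J R X n T α) (ψ : State J R X n) :
    ((P.runPunctured f S ψ).map fun q => normSq q.2).sum = normSq ψ := by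
  induction P generalizing ψ with
  | ret a => simp [runPunctured]
  | step K hK next ih =>
    rw [runPunctured, sum_map_bind_univ]
    simp only [ih]
    exact sum_normSq_applyLocal K hK ψ
  | queryRO e next ih =>
    rw [runPunctured, sum_map_bind_univ]
    simp only [Multiset.map_map, Function.comp_def, ih, normSq_applyRO, Fintype.sum_bool]
    exact sum_normSq_semiClassical S e ψ
  | queryE t next ih =>
    rw [runPunctured, sum_map_bind_univ]
    simp only [ih]
    exact sum_normSq_applyE f t ψ

theorem findWeight_queryRO (f : X → Bits n → T) (S : Finset X) {k : ℕ} (e : Fin k ↪ J)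
    (next : OracleAlg J R X n T α) (ψ : State J R X n) :
    (queryRO e next).findWeight f S ψ = normSq (semiClassical S e true ψ)
      + next.findWeight f S (applyRO e (semiClassical S e false ψ)) := by
  rw [findWeight, runPunctured, sum_map_bind_univ, Fintype.sum_bool]
  congr 1
  · simp [Multiset.map_map, sum_normSq_runPunctured, normSq_applyRO]
  · simp [Multiset.map_map, findWeight]

theorem hitWeight_extractor_queryRO_zero (f : X → Bits n → T) (S : Finset X) {k : ℕ}
    (e : Fin k ↪ J) (next : OracleAlg J R X n T α) (ψ : State J R X n) :
    ((queryRO e next).extractor 0).hitWeight f S ψ = normSq (semiClassical S e true ψ) := by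
  rw [hitWeight, extractor, run, sum_map_bind_univ, ← sum_normSq_measureInputs]
  simp [run]

/-- Semi-classical one-way to hiding for a punctured run from `ψ` and an unpunctured run from
`ψ'`. -/
theorem findWeight_le (f : X → Bits n → T) (S : Finset X) (P : OracleAlg J R X n T α) (d : ℕ)
    (hd : P.queryDepth ≤ d) (ψ ψ' : State J R X n) :
    P.findWeight f S ψ ≤ 2 * normSq (ψ' - ψ)
      + 4 * ∑ i ∈ Finset.range d, (P.extractor i).hitWeight f S ψ' := by
  induction P generalizing d ψ ψ' with
  | ret a =>
    have h : (ret a : OracleAlg J R X n T α).findWeight f S ψ = 0 := by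
      simp [findWeight, runPunctured]
    rw [h]
    exact add_nonneg (mul_nonneg zero_le_two (normSq_nonneg _))
      (mul_nonneg zero_le_four (Finset.sum_nonneg fun i _ => hitWeight_nonneg _ _ _ _))
  | step K hK next ih =>
    have hf : (step K hK next).findWeight f S ψ
        = ∑ i, (next i).findWeight f S (applyLocal (K i) ψ) := by
      rw [findWeight, runPunctured, sum_map_bind_univ]
      rfl
    have he : ∀ m, ((step K hK next).extractor m).hitWeight f S ψ'
        = ∑ i, ((next i).extractor m).hitWeight f S (applyLocal (K i) ψ') := by
      intro m
      rw [hitWeight, extractor, run, sum_map_bind_univ]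
      rfl
    simp only [he]
    -- Completeness of the Kraus family splits the squared distance over the outcomes, so the bound
    -- can be proved outcome by outcome.
    rw [hf, ← sum_normSq_applyLocal K hK, Finset.sum_comm, Finset.mul_sum, Finset.mul_sum,
      ← Finset.sum_add_distrib]
    refine Finset.sum_le_sum fun i _ => ?_
    rw [applyLocal_sub]
    exact ih i d ((Finset.le_sup (f := fun i => (next i).queryDepth) (Finset.mem_univ i)).trans hd)
      _ _
  | queryRO e next ih =>
    -- A program that begins with a query has positive depth, so one unit of `d` can be spent here.
    obtain ⟨d, rfl⟩ := Nat.exists_eq_add_one_of_ne_zero (n := d)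
      (fun h => by simp [queryDepth, h] at hd)
    have he : ∀ m, ((queryRO e next).extractor (m + 1)).hitWeight f S ψ'
        = (next.extractor m).hitWeight f S (applyRO e ψ') := by
      intro m
      rw [hitWeight, extractor, run]
      rfl
    -- The term `i = 0` measures the present query; the others are the extractors of the
    -- continuation, shifted by one.
    rw [findWeight_queryRO, Finset.sum_range_succ', hitWeight_extractor_queryRO_zero]
    simp only [he]
    -- The punctured state loses its part on `S` while `ψ'` stays whole, so the distance grows only
    -- by the part of `ψ'` on `S`.
    have h1 := ih d (Nat.le_of_succ_le_succ hd) (applyRO e (semiClassical S e false ψ))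
      (applyRO e ψ')
    rw [← applyRO_sub, normSq_applyRO, normSq_sub_semiClassical] at h1
    -- Write the flagged part of `ψ` as that of `ψ'` minus that of `ψ' - ψ`. The latter, with the
    -- unflagged part of the distance in `h1`, uses up exactly `2‖ψ' - ψ‖²`.
    have h2 := normSq_sub_le (semiClassical S e true ψ') (semiClassical S e true (ψ' - ψ))
    rw [← semiClassical_sub, sub_sub_cancel] at h2
    have h3 := sum_normSq_semiClassical S e (ψ' - ψ)
    linarith
  | queryE t next ih =>
    have hf : (queryE t next).findWeight f S ψ
        = ∑ o, (next o).findWeight f S (applyE f t o ψ) := by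
      rw [findWeight, runPunctured, sum_map_bind_univ]
      rfl
    have he : ∀ m, ((queryE t next).extractor m).hitWeight f S ψ'
        = ∑ o, ((next o).extractor m).hitWeight f S (applyE f t o ψ') := by
      intro m
      rw [hitWeight, extractor, run, sum_map_bind_univ]
      rfl
    simp only [he]
    rw [hf, ← sum_normSq_applyE f t, Finset.sum_comm, Finset.mul_sum, Finset.mul_sum,
      ← Finset.sum_add_distrib]
    refine Finset.sum_le_sum fun o _ => ?_
    rw [applyE_sub]
    exact ih o d ((Finset.le_sup (f := fun o => (next o).queryDepth) (Finset.mem_univ o)).trans hd)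
      _ _

theorem findWeight_le_sum_hitWeight (f : X → Bits n → T) (S : Finset X)
    (P : OracleAlg J R X n T α) (d : ℕ) (hd : P.queryDepth ≤ d) (ψ : State J R X n) :
    P.findWeight f S ψ ≤ 4 * ∑ i ∈ Finset.range d, (P.extractor i).hitWeight f S ψ := by
  have h := P.findWeight_le f S d hd ψ ψ
  rwa [sub_self, normSq_zero, mul_zero, zero_add] at h

end OracleAlg

end Runs

end ECO

/-! ### Averaging over the generated input and over the extractor's index -/

theorem mainTheorem8
    {X T Inp β J R J₀ R₀ : Type} {n : ℕ} [Fintype X] [LinearOrder X]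
    [Fintype J] [DecidableEq J] [Fintype R] [DecidableEq R]
    [Fintype J₀] [DecidableEq J₀] [Fintype R₀] [DecidableEq R₀]
    (f : X → ECO.Bits n → T) (c : ECO.OracleLink) (d : ℕ)
    (G : ECO.QAlg J₀ R₀ X n T (Inp × Finset X))
    (A : Inp → ECO.QAlg J R X n T β)
    (hA : ∀ inp, (A inp).prog.queryDepth ≤ d) :
    ECO.prFind f c G A ≤ 4 * d * ECO.prExtract f c d G A := by
  -- The bound holds separately in each branch of the input phase, where `inp`, `S''` and the
  -- database state are fixed; no independence between them is needed.
  have key : ECO.prFind f c G A ≤ 4 * ∑ i ∈ Finset.range d,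
      ((ECO.inputPhase f c G).map fun p =>
        (((A p.1.1).prog.extractor i).hitWeight f p.1.2
          (ECO.tensor (A p.1.1).init p.2))).sum := by
    rw [← Multiset.sum_map_sum, ← Multiset.sum_map_mul_left]
    exact Multiset.sum_map_le_sum_map _ _ fun p _ =>
      (A p.1.1).prog.findWeight_le_sum_hitWeight f p.1.2 d (hA _) _
  -- For `d = 0` the factor `d` makes the right-hand side 0, and the sum in `key` is empty.
  -- Otherwise `d` cancels the uniform weight `1 / d`.
  rcases Nat.eq_zero_or_pos d with rfl | hd
  · simpa using key
  · have hd' : (d : ℝ) ≠ 0 := by positivity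
    refine key.trans_eq ?_
    rw [ECO.prExtract, ← mul_assoc, mul_assoc 4, mul_one_div_cancel hd', mul_one]
    rfl
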